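/- Let $\nu$ be a random variable with values in $\{1,2,\dots\}$ such that $\mathbf E(t^{\nu})<\infty$ for some $t>1$ and $m:=\mathbf E(\nu)>1$. Let $Y_0$ be a random variable with values in $(0,\infty)$. For $p\in[0,1]$, let $X_0$ have the law $(1-p)\,\delta_0+p\,P_{Y_0}$, where $\delta_0$ is the Dirac measure at $0$ and $P_{Y_0}$ is the law of $Y_0$, and define the laws of $X_1,X_2,\dots$ recursively by $$X_{n+1}\overset{\mathrm{law}}{=}(X_{n,1}+\cdots+X_{n,\nu}-1)^+,\qquad n\ge 0,$$ where $X_{n,1},X_{n,2},\dots$ are independent copies of $X_n$, independent of $\nu$. Let $\theta\in(0,\log m)$, and assume that there are constants $0<c_1\le c_2<\infty$ such that, for all sufficiently large $x$, $$c_1e^{-\theta x}\le \mathbb P(Y_0\ge x)\le c_2e^{-\theta x}.$$ Then, for every $p\in[0,1]$, all the $X_n$ have finite expectation and the limit (the free energy) $$F_\infty(p):=\lim_{n\to\infty}\frac{\mathbb E(X_n)}{m^n}$$ exists and is finite, and $$F_\infty(p)=p^{\beta+o(1)}\quad\text{as }p\downarrow 0,\qquad\text{where}\quad \beta=\frac{\log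 m}{\log m-\theta}.$$ -/

import Mathlib

open MeasureTheory Filter Topology

namespace DerridaRetaux

/-- One step of the recursion at the level of laws. If `ρ` is the law of `ν` and `μ` is the law of
`X`, this is the law of `(X₁ + ⋯ + X_ν - 1)⁺`, where `X₁, X₂, …` are independent copies of `X`,
independent of `ν`: conditionally on `ν = k`, the vector `(X₁, …, X_k)` has the product law
`μ ⊗ ⋯ ⊗ μ` (`k` factors). -/
noncomputable def step (ρ : Measure ℕ) (μ : Measure ℝ) : Measure ℝ :=
  ρ.bind fun k => (Measure.pi fun _ : Fin k => μ).map fun x => max (∑ i, x i - 1) 0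

/-- The law `(1 - p) δ₀ + p P_{Y₀}` of `X₀`, where `η = P_{Y₀}` is the law of `Y₀`. -/
noncomputable def initialLaw (η : Measure ℝ) (p : ℝ) : Measure ℝ :=
  ENNReal.ofReal (1 - p) • Measure.dirac 0 + ENNReal.ofReal p • η

/-- The law of `X_n`, where `ρ` is the law of `ν` and `η` is the law of `Y₀`. -/
noncomputable def law (ρ : Measure ℕ) (η : Measure ℝ) (p : ℝ) : ℕ → Measure ℝ
  | 0 => initialLaw η p
  | n + 1 => step ρ (law ρ η p n)

/-- The mean `m = E(ν)`, where `ρ` is the law of `ν`. -/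
noncomputable def offspringMean (ρ : Measure ℕ) : ℝ := ∫ k, (k : ℝ) ∂ρ

/-- The normalised expectation `E(X_n) / m ^ n`. -/
noncomputable def normalizedMean (ρ : Measure ℕ) (η : Measure ℝ) (p : ℝ) (n : ℕ) : ℝ :=
  (∫ x, x ∂(law ρ η p n)) / offspringMean ρ ^ n

/-- The free energy `F_∞(p) = lim_{n → ∞} E(X_n) / m ^ n`. -/
noncomputable def freeEnergy (ρ : Measure ℕ) (η : Measure ℝ) (p : ℝ) : ℝ :=
  limUnder atTop (normalizedMean ρ η p)

end DerridaRetaux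

namespace DerridaRetaux

open scoped ENNReal

/-! Write `F` for the free energy. It is squeezed between powers of `p` whose exponents are
arbitrarily close to `β`. Upper bound: cut `Y₀` at `L = a log (1/p)`. The map `x ↦ (∑ xᵢ - 1)⁺` is
monotone and 1-Lipschitz in the sum, so the part cut off adds at most `p E(Y₀ - L)⁺ ≈ p ^ (1 + θ a)`
to `F` (`posMean_law_le_truncated`). For `s > log m`, a small exponential moment excess at `s` does
not grow, since a step multiplies it by about `m e^{-s} < 1` (`expMoment_law_le`). The truncated
start has excess about `p e^{(s - θ) L}`, which is small if `a (s - θ) < 1`; its means then stay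
bounded and contribute nothing to `F`. Letting `s ↓ log m` and `a ↑ 1/(log m - θ)` gives `1 + θ a →
β`. Lower bound: one large summand is enough, so `P(X_{n+1} ≥ x)` is nearly `m P(X_n ≥ x + 1)` or
more while it is small (`law_Iio_le`). From `p e^{-θ (x + n)}` it grows to order one after `n ≈ log
(1/p) / (log m - θ)` steps. Once `E(X_n)` exceeds `1/(m - 1) + 1`, `F ≥ m^{-n} ≈ p^β`
(`le_freeEnergy_of_le_integral`). -/

/-- The law of `F ν (Z₁, …, Z_ν)`, where the `Z_i` are independent with law `γ` and `ν` is
independent of them, with law `ρ`. -/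
noncomputable def bindPi {E E' : Type*} [MeasurableSpace E] [MeasurableSpace E'] (ρ : Measure ℕ)
    (γ : Measure E) (F : ∀ k : ℕ, (Fin k → E) → E') : Measure E' :=
  ρ.bind fun k => (Measure.pi fun _ : Fin k => γ).map (F k)

/-! ### Functionals of a random number of independent copies. -/

section General

variable {E E' : Type*} [MeasurableSpace E] [MeasurableSpace E']
  {ρ : Measure ℕ} {γ : Measure E}

lemma lintegral_bindPi {F : ∀ k : ℕ, (Fin k → E) → E'} (hF : ∀ k, Measurable (F k))
    {g : E' → ℝ≥0∞} (hg : Measurable g) :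
    ∫⁻ y, g y ∂(bindPi ρ γ F) = ∫⁻ k, ∫⁻ x, g (F k x) ∂(Measure.pi fun _ : Fin k => γ) ∂ρ := by
  rw [bindPi, Measure.lintegral_bind (measurable_of_countable _).aemeasurable hg.aemeasurable]
  refine lintegral_congr fun k => ?_
  rw [lintegral_map hg (hF k)]

lemma isProbabilityMeasure_bindPi [IsProbabilityMeasure ρ] [IsProbabilityMeasure γ]
    {F : ∀ k : ℕ, (Fin k → E) → E'} (hF : ∀ k, Measurable (F k)) :
    IsProbabilityMeasure (bindPi ρ γ F) :=
  isProbabilityMeasure_bind (measurable_of_countable _).aemeasurable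
    (ae_of_all _ fun k => Measure.isProbabilityMeasure_map (hF k).aemeasurable)

/-- Serves to show that the marginals of a coupled recursion follow the original recursion. -/
lemma map_bindPi [IsProbabilityMeasure γ] {F : ∀ k : ℕ, (Fin k → E) → E}
    {F' : ∀ k : ℕ, (Fin k → E') → E'} (hF : ∀ k, Measurable (F k))
    (hF' : ∀ k, Measurable (F' k)) {π : E → E'} (hπ : Measurable π)
    (h : ∀ k x, π (F k x) = F' k fun i => π (x i)) :
    (bindPi ρ γ F).map π = bindPi ρ (γ.map π) F' := by
  have := Measure.isProbabilityMeasure_map (μ := γ) hπ.aemeasurable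
  refine Measure.ext_of_lintegral _ fun g hg => ?_
  rw [lintegral_map hg hπ, lintegral_bindPi (g := fun y => g (π y)) hF (hg.comp hπ),
    lintegral_bindPi hF' hg]
  refine lintegral_congr fun k => ?_
  rw [← Measure.pi_map_pi fun _ => hπ.aemeasurable,
    lintegral_map (f := fun x => g (F' k x)) (hg.comp (hF' k)) (by fun_prop)]
  simp [h]

lemma lintegral_pi_sum [IsProbabilityMeasure γ] {h : E → ℝ≥0∞} (hh : Measurable h) (k : ℕ) :
    ∫⁻ x, ∑ i, h (x i) ∂(Measure.pi fun _ : Fin k => γ) = k * ∫⁻ y, h y ∂γ := by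
  rw [lintegral_finsetSum (f := fun i (x : Fin k → E) => h (x i)) _
    fun i _ => hh.comp (measurable_pi_apply i)]
  have (i : Fin k) : ∫⁻ x, h (x i) ∂(Measure.pi fun _ : Fin k => γ) = ∫⁻ y, h y ∂γ :=
    (measurePreserving_eval (fun _ : Fin k => γ) i).lintegral_comp hh
  simp [this]

lemma lintegral_pi_prod [IsProbabilityMeasure γ] {h : E → ℝ≥0∞} (hh : Measurable h) (k : ℕ) :
    ∫⁻ x, ∏ i, h (x i) ∂(Measure.pi fun _ : Fin k => γ) = (∫⁻ y, h y ∂γ) ^ k := by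
  rw [ProbabilityTheory.lintegral_prod_eq_prod_lintegral_of_indepFun Finset.univ
    (fun i (x : Fin k → E) => h (x i)) (ProbabilityTheory.iIndepFun_pi fun _ => hh.aemeasurable)
    fun i => hh.comp (measurable_pi_apply i)]
  have (i : Fin k) : ∫⁻ x, h (x i) ∂(Measure.pi fun _ : Fin k => γ) = ∫⁻ y, h y ∂γ :=
    (measurePreserving_eval (fun _ : Fin k => γ) i).lintegral_comp hh
  simp [this]

lemma ae_bindPi {F : ∀ k : ℕ, (Fin k → E) → E'} (hF : ∀ k, Measurable (F k))
    {s : Set E'} (hs : MeasurableSet s) (h : ∀ k x, F k x ∈ s) : ∀ᵐ y ∂(bindPi ρ γ F), y ∈ s := by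
  rw [ae_iff, ← Set.compl_def, bindPi,
    Measure.bind_apply hs.compl (measurable_of_countable _).aemeasurable]
  simp [Measure.map_apply (hF _) hs.compl, Set.preimage, h]

end General

/-- The map `x ↦ (x₁ + ⋯ + x_k - 1)⁺`. -/
noncomputable def sumSubOnePos (k : ℕ) (x : Fin k → ℝ) : ℝ := max (∑ i, x i - 1) 0

lemma measurable_sumSubOnePos (k : ℕ) : Measurable (sumSubOnePos k) := by
  unfold sumSubOnePos; fun_prop

lemma step_eq_bindPi (ρ : Measure ℕ) (μ : Measure ℝ) : step ρ μ = bindPi ρ μ sumSubOnePos := rfl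

/-- The mean of the positive part of a law on `ℝ`, in `[0, ∞]`. -/
noncomputable def posMean (μ : Measure ℝ) : ℝ≥0∞ := ∫⁻ x, ENNReal.ofReal x ∂μ

/-! ### One step of the recursion: mean, lower tail, exponential moment. -/

section Step

variable {ρ : Measure ℕ} {μ : Measure ℝ}

instance isProbabilityMeasure_step [IsProbabilityMeasure ρ] [IsProbabilityMeasure μ] :
    IsProbabilityMeasure (step ρ μ) :=
  isProbabilityMeasure_bindPi measurable_sumSubOnePos

lemma ae_nonneg_step : ∀ᵐ x ∂(step ρ μ), 0 ≤ x :=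
  ae_bindPi measurable_sumSubOnePos (s := Set.Ici 0) measurableSet_Ici
    fun _ _ => Set.mem_Ici.2 (le_max_right _ _)

lemma posMean_step_le [IsProbabilityMeasure μ] :
    posMean (step ρ μ) ≤ (∫⁻ k, (k : ℝ≥0∞) ∂ρ) * posMean μ := by
  rw [posMean, step_eq_bindPi, lintegral_bindPi measurable_sumSubOnePos ENNReal.measurable_ofReal,
    ← lintegral_mul_const _ (measurable_of_countable _)]
  refine lintegral_mono fun k => ?_
  rw [posMean, ← lintegral_pi_sum ENNReal.measurable_ofReal]
  refine lintegral_mono fun x => ?_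
  rw [sumSubOnePos, ENNReal.ofReal_max, ENNReal.ofReal_zero, max_eq_left (zero_le)]
  exact (ENNReal.ofReal_le_ofReal (by linarith)).trans
    (Finset.le_sum_of_subadditive _ ENNReal.ofReal_zero.le (fun _ _ => ENNReal.ofReal_add_le) _ _)

lemma le_posMean_step_add_one [IsProbabilityMeasure ρ] [IsProbabilityMeasure μ]
    (hμ : ∀ᵐ x ∂μ, 0 ≤ x) :
    (∫⁻ k, (k : ℝ≥0∞) ∂ρ) * posMean μ ≤ posMean (step ρ μ) + 1 := by
  have h1 : (1 : ℝ≥0∞) = ∫⁻ _, 1 ∂(step ρ μ) := by simp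
  rw [posMean, posMean, h1, ← lintegral_add_right _ measurable_const, step_eq_bindPi,
    lintegral_bindPi measurable_sumSubOnePos (by fun_prop),
    ← lintegral_mul_const _ (measurable_of_countable _)]
  refine lintegral_mono fun k => ?_
  rw [← lintegral_pi_sum ENNReal.measurable_ofReal]
  have hae : ∀ᵐ x ∂(Measure.pi fun _ : Fin k => μ), ∀ i, 0 ≤ x i :=
    eventually_all.2 fun i => Measure.tendsto_eval_ae_ae.eventually hμ
  refine lintegral_mono_ae (hae.mono fun x hx => ?_)
  have := le_max_left (∑ i, x i - 1) 0
  rw [sumSubOnePos, ← ENNReal.ofReal_sum_of_nonneg fun i _ => hx i, ← ENNReal.ofReal_one,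
    ← ENNReal.ofReal_add (le_max_right _ _) zero_le_one]
  exact ENNReal.ofReal_le_ofReal (by linarith)

/-- A sum of nonnegative terms below `x + 1` has every term below `x + 1`. -/
lemma step_Iio_le [IsProbabilityMeasure μ] (hμ : ∀ᵐ x ∂μ, 0 ≤ x) (x : ℝ) :
    step ρ μ (Set.Iio x) ≤ ∫⁻ k, μ (Set.Iio (x + 1)) ^ k ∂ρ := by
  rw [step_eq_bindPi, bindPi,
    Measure.bind_apply measurableSet_Iio (measurable_of_countable _).aemeasurable]
  refine lintegral_mono fun k => ?_
  rw [Measure.map_apply (measurable_sumSubOnePos k) measurableSet_Iio]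
  have hae : ∀ᵐ x ∂(Measure.pi fun _ : Fin k => μ), ∀ i, 0 ≤ x i :=
    eventually_all.2 fun i => Measure.tendsto_eval_ae_ae.eventually hμ
  have hpi : (Measure.pi fun _ : Fin k => μ) (Set.univ.pi fun _ => Set.Iio (x + 1)) =
      μ (Set.Iio (x + 1)) ^ k := by simp [Measure.pi_pi]
  rw [← hpi]
  refine measure_mono_ae (hae.mono fun y hy hyx => ?_)
  have hlt : ∑ i, y i - 1 < x := (le_max_left _ _).trans_lt hyx
  intro i _
  have := Finset.single_le_sum (fun j _ => hy j) (Finset.mem_univ i)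
  simp only [Set.mem_Iio]
  linarith

/-- The exponential moment of the positive part. -/
noncomputable def expMoment (s : ℝ) (μ : Measure ℝ) : ℝ≥0∞ :=
  ∫⁻ x, ENNReal.ofReal (Real.exp (s * max x 0)) ∂μ

/-- For `S ≥ 0`, `e^{s (S - 1)⁺} ≤ 1 - e^{-s} + e^{-s} e^{s S}`; independence turns `e^{s S}` into a
power. -/
lemma expMoment_step_le [IsProbabilityMeasure ρ] [IsProbabilityMeasure μ] {s : ℝ} (hs : 0 ≤ s) :
    expMoment s (step ρ μ) ≤ ENNReal.ofReal (1 - Real.exp (-s)) +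
      ENNReal.ofReal (Real.exp (-s)) * ∫⁻ k, expMoment s μ ^ k ∂ρ := by
  have hmeas : Measurable fun x : ℝ => ENNReal.ofReal (Real.exp (s * max x 0)) := by fun_prop
  have hc : ENNReal.ofReal (1 - Real.exp (-s)) = ∫⁻ _, ENNReal.ofReal (1 - Real.exp (-s)) ∂ρ := by
    simp
  rw [expMoment, step_eq_bindPi, lintegral_bindPi measurable_sumSubOnePos hmeas, hc,
    ← lintegral_const_mul _ (measurable_of_countable _),
    ← lintegral_add_left measurable_const]
  refine lintegral_mono fun k => ?_
  rw [expMoment, ← lintegral_pi_prod hmeas]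
  have hc' : ENNReal.ofReal (1 - Real.exp (-s)) =
      ∫⁻ _, ENNReal.ofReal (1 - Real.exp (-s)) ∂(Measure.pi fun _ : Fin k => μ) := by simp
  rw [← lintegral_const_mul _ (by fun_prop), hc', ← lintegral_add_left measurable_const]
  refine lintegral_mono fun x => ?_
  rw [← ENNReal.ofReal_prod_of_nonneg fun _ _ => (Real.exp_pos _).le, ← Real.exp_sum,
    ← Finset.mul_sum, ← ENNReal.ofReal_mul (Real.exp_pos _).le,
    ← ENNReal.ofReal_add (by simpa using hs) (by positivity), ← Real.exp_add]
  refine ENNReal.ofReal_le_ofReal ?_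
  have hS : ∑ i, x i ≤ ∑ i, max (x i) 0 := Finset.sum_le_sum fun i _ => le_max_left _ _
  have hS0 : 0 ≤ ∑ i, max (x i) 0 := Finset.sum_nonneg fun i _ => le_max_right _ _
  set S := ∑ i, max (x i) 0
  have he : Real.exp (-s) ≤ 1 := by simpa using hs
  rw [sumSubOnePos, max_assoc, max_self]
  rcases le_total (∑ i, x i - 1) 0 with h | h
  · rw [max_eq_right h, mul_zero, Real.exp_zero]
    have : Real.exp (-s) ≤ Real.exp (-s + s * S) := Real.exp_le_exp.2 (by nlinarith)
    linarith
  · rw [max_eq_left h]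
    have : Real.exp (s * (∑ i, x i - 1)) ≤ Real.exp (-s + s * S) :=
      Real.exp_le_exp.2 (by nlinarith)
    linarith

end Step

/-! ### Second-order control of the generating function of `ν` near `1`. -/

section PowerBounds

/-- The remainder `R_k(u) = (1 + u)^k - 1 - k u` satisfies `R_{k+1}(u) = (1 + u) R_k(u) + k u²`, so
`R_k(u) / u²` is largest at `u = d`. Negative `u` serves the lower bound on the free energy,
positive `u` the upper one. -/
lemma one_add_pow_le {u d : ℝ} (hd : 0 < d) (hu : -1 ≤ u) (hud : u ≤ d) (k : ℕ) :
    (1 + u) ^ k ≤ 1 + k * u + (u / d) ^ 2 * ((1 + d) ^ k - 1 - k * d) := by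
  have hB (k : ℕ) : 0 ≤ (1 + d) ^ k - 1 - k * d := by
    have := one_add_mul_le_pow (a := d) (by linarith) k
    linarith
  induction k with
  | zero => simp
  | succ k ih =>
    have h1 : (1 + u) * (1 + u) ^ k ≤
        (1 + u) * (1 + k * u + (u / d) ^ 2 * ((1 + d) ^ k - 1 - k * d)) :=
      mul_le_mul_of_nonneg_left ih (by linarith)
    have h2 : (1 + u) * ((u / d) ^ 2 * ((1 + d) ^ k - 1 - k * d)) ≤
        (1 + d) * ((u / d) ^ 2 * ((1 + d) ^ k - 1 - k * d)) :=
      mul_le_mul_of_nonneg_right (by linarith) (mul_nonneg (sq_nonneg _) (hB k))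
    have h3 : (u / d) ^ 2 * (k * d ^ 2) = k * u ^ 2 := by field_simp
    rw [pow_succ' (1 + u), pow_succ' (1 + d)]
    push_cast
    linear_combination h1 + h2 - h3

variable {ρ : Measure ℕ} {d : ℝ}

lemma integrable_natCast_of_pow (hd : 0 < d) (h : Integrable (fun k : ℕ => (1 + d) ^ k) ρ) :
    Integrable (fun k : ℕ => (k : ℝ)) ρ := by
  refine (h.div_const d).mono' (measurable_of_countable _).aestronglyMeasurable
    (ae_of_all _ fun k => ?_)
  have := one_add_mul_le_pow (a := d) (by linarith) k
  rw [Real.norm_of_nonneg (Nat.cast_nonneg k), le_div_iff₀ hd]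
  linarith

lemma lintegral_natCast (h : Integrable (fun k : ℕ => (k : ℝ)) ρ) :
    ∫⁻ k, (k : ℝ≥0∞) ∂ρ = ENNReal.ofReal (offspringMean ρ) := by
  rw [offspringMean, ofReal_integral_eq_lintegral_ofReal h (ae_of_all _ fun k => Nat.cast_nonneg k)]
  simp

variable [IsProbabilityMeasure ρ]

lemma lintegral_one_add_pow_le (hd : 0 < d) (h : Integrable (fun k : ℕ => (1 + d) ^ k) ρ)
    {u : ℝ} (hu : -1 ≤ u) (hud : u ≤ d) :
    ∫⁻ k, ENNReal.ofReal (1 + u) ^ k ∂ρ ≤ ENNReal.ofReal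
      (1 + offspringMean ρ * u + (∫ k : ℕ, (1 + d) ^ k ∂ρ) / d ^ 2 * u ^ 2) := by
  have hk := integrable_natCast_of_pow hd h
  have hbound (k : ℕ) : (1 + u) ^ k ≤ 1 + k * u + (u / d) ^ 2 * (1 + d) ^ k := by
    have h1 := one_add_pow_le hd hu hud k
    have : 0 ≤ (u / d) ^ 2 * (1 + k * d) := by positivity
    linarith
  have hint1 : Integrable (fun k : ℕ => 1 + (k : ℝ) * u) ρ :=
    (integrable_const _).add (hk.mul_const u)
  have hint2 : Integrable (fun k : ℕ => (u / d) ^ 2 * (1 + d) ^ k) ρ := h.const_mul _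
  have hint : Integrable (fun k : ℕ => 1 + (k : ℝ) * u + (u / d) ^ 2 * (1 + d) ^ k) ρ :=
    hint1.add hint2
  have heq : ∫ k : ℕ, (1 + k * u + (u / d) ^ 2 * (1 + d) ^ k) ∂ρ =
      1 + offspringMean ρ * u + (∫ k : ℕ, (1 + d) ^ k ∂ρ) / d ^ 2 * u ^ 2 := by
    rw [integral_add hint1 hint2, integral_add (integrable_const _) (hk.mul_const u),
      integral_mul_const, integral_const_mul, offspringMean]
    simp
    ring
  rw [← heq, ofReal_integral_eq_lintegral_ofReal hint
    (ae_of_all _ fun k => (pow_nonneg (by linarith) k).trans (hbound k))]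
  refine lintegral_mono fun k => ?_
  rw [← ENNReal.ofReal_pow (by linarith)]
  exact ENNReal.ofReal_le_ofReal (hbound k)

lemma exists_forall_lintegral_one_sub_pow_le (hd : 0 < d)
    (h : Integrable (fun k : ℕ => (1 + d) ^ k) ρ) {r : ℝ} (hr : r < offspringMean ρ) :
    ∃ δ : ℝ, 0 < δ ∧ δ ≤ 1 ∧ ∀ q, 0 ≤ q → q ≤ δ →
      ∫⁻ k, ENNReal.ofReal (1 - q) ^ k ∂ρ ≤ ENNReal.ofReal (1 - r * q) := by
  set K := (∫ k : ℕ, (1 + d) ^ k ∂ρ) / d ^ 2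
  have hK : 0 ≤ K := div_nonneg (integral_nonneg fun k => by positivity) (by positivity)
  -- The slack `(m - r) q` in the linear term absorbs the quadratic error `K q²`; `K + 1` avoids
  -- dividing by zero.
  refine ⟨min 1 ((offspringMean ρ - r) / (K + 1)), lt_min one_pos (div_pos (by linarith)
    (by linarith)), min_le_left _ _, fun q hq hqδ => ?_⟩
  have hq1 := hqδ.trans (min_le_left _ _)
  have hq2 := hqδ.trans (min_le_right _ _)
  rw [le_div_iff₀ (by linarith)] at hq2
  refine (lintegral_one_add_pow_le hd h (u := -q) (by linarith) (by linarith)).trans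
    (ENNReal.ofReal_le_ofReal ?_)
  nlinarith

lemma exists_lintegral_one_add_pow_le (hd : 0 < d)
    (h : Integrable (fun k : ℕ => (1 + d) ^ k) ρ) {r : ℝ} (hr : offspringMean ρ < r) :
    ∃ δ : ℝ, 0 < δ ∧ ∫⁻ k, ENNReal.ofReal (1 + δ) ^ k ∂ρ ≤ ENNReal.ofReal (1 + r * δ) := by
  set K := (∫ k : ℕ, (1 + d) ^ k ∂ρ) / d ^ 2
  have hK : 0 ≤ K := div_nonneg (integral_nonneg fun k => by positivity) (by positivity)
  set δ := min d ((r - offspringMean ρ) / (K + 1))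
  have hδ : 0 < δ := lt_min hd (div_pos (by linarith) (by linarith))
  have hq2 : δ ≤ _ := min_le_right _ _
  rw [le_div_iff₀ (by linarith)] at hq2
  refine ⟨δ, hδ, (lintegral_one_add_pow_le hd h (by linarith) (min_le_left _ _)).trans
    (ENNReal.ofReal_le_ofReal ?_)⟩
  nlinarith

end PowerBounds

/-! ### The law of `X_n` and its coupling with the truncated start. -/

section Law

variable {ρ : Measure ℕ} {η : Measure ℝ} {p : ℝ}

lemma isProbabilityMeasure_initialLaw [IsProbabilityMeasure η] (hp0 : 0 ≤ p) (hp1 : p ≤ 1) :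
    IsProbabilityMeasure (initialLaw η p) := by
  constructor
  simp only [initialLaw, Measure.add_apply, Measure.smul_apply, measure_univ, smul_eq_mul, mul_one]
  rw [← ENNReal.ofReal_add (by linarith) hp0]
  simp

lemma isProbabilityMeasure_law [IsProbabilityMeasure ρ] [IsProbabilityMeasure η] (hp0 : 0 ≤ p)
    (hp1 : p ≤ 1) (n : ℕ) : IsProbabilityMeasure (law ρ η p n) := by
  induction n with
  | zero => exact isProbabilityMeasure_initialLaw hp0 hp1
  | succ n ih => exact isProbabilityMeasure_step

lemma ae_nonneg_law (hη : ∀ᵐ x ∂η, 0 ≤ x) (n : ℕ) : ∀ᵐ x ∂(law ρ η p n), 0 ≤ x := by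
  cases n with
  | zero =>
    rw [law, initialLaw, ae_add_measure_iff]
    refine ⟨Measure.ae_smul_measure ?_ _, Measure.ae_smul_measure hη _⟩
    rw [ae_dirac_iff measurableSet_Ici]
  | succ n => exact ae_nonneg_step

lemma lintegral_initialLaw {g : ℝ → ℝ≥0∞} (hg : Measurable g) :
    ∫⁻ x, g x ∂(initialLaw η p) =
      ENNReal.ofReal (1 - p) * g 0 + ENNReal.ofReal p * ∫⁻ x, g x ∂η := by
  rw [initialLaw, lintegral_add_measure, lintegral_smul_measure, lintegral_smul_measure,
    lintegral_dirac' _ hg, smul_eq_mul, smul_eq_mul]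

lemma map_initialLaw {f : ℝ → ℝ} (hf : Measurable f) (hf0 : f 0 = 0) :
    (initialLaw η p).map f = initialLaw (η.map f) p := by
  rw [initialLaw, initialLaw, Measure.map_add _ _ hf, Measure.map_smul, Measure.map_smul,
    Measure.map_dirac' hf, hf0]

/-- The joint law of two copies of the recursion driven by the same randomness, started from the
coupling `γ`. -/
noncomputable def coupledLaw (ρ : Measure ℕ) (γ : Measure (ℝ × ℝ)) : ℕ → Measure (ℝ × ℝ)
  | 0 => γ
  | n + 1 => bindPi ρ (coupledLaw ρ γ n) fun k z =>
      (sumSubOnePos k fun i => (z i).1, sumSubOnePos k fun i => (z i).2)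

lemma measurable_sumSubOnePos_prod (k : ℕ) : Measurable fun z : Fin k → ℝ × ℝ =>
    (sumSubOnePos k fun i => (z i).1, sumSubOnePos k fun i => (z i).2) := by
  have := measurable_sumSubOnePos k
  fun_prop

variable [IsProbabilityMeasure ρ]

lemma isProbabilityMeasure_coupledLaw {γ : Measure (ℝ × ℝ)} [IsProbabilityMeasure γ] (n : ℕ) :
    IsProbabilityMeasure (coupledLaw ρ γ n) := by
  induction n with
  | zero => assumption
  | succ n ih => exact isProbabilityMeasure_bindPi measurable_sumSubOnePos_prod

lemma map_fst_coupledLaw {γ : Measure (ℝ × ℝ)} [IsProbabilityMeasure γ]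
    (h : γ.map Prod.fst = initialLaw η p) (n : ℕ) :
    (coupledLaw ρ γ n).map Prod.fst = law ρ η p n := by
  induction n with
  | zero => exact h
  | succ n ih =>
    have := isProbabilityMeasure_coupledLaw (ρ := ρ) (γ := γ) n
    rw [coupledLaw, law, step_eq_bindPi, ← ih]
    exact map_bindPi measurable_sumSubOnePos_prod measurable_sumSubOnePos measurable_fst
      fun _ _ => rfl

lemma map_snd_coupledLaw {γ : Measure (ℝ × ℝ)} [IsProbabilityMeasure γ]
    (h : γ.map Prod.snd = initialLaw η p) (n : ℕ) :
    (coupledLaw ρ γ n).map Prod.snd = law ρ η p n := by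
  induction n with
  | zero => exact h
  | succ n ih =>
    have := isProbabilityMeasure_coupledLaw (ρ := ρ) (γ := γ) n
    rw [coupledLaw, law, step_eq_bindPi, ← ih]
    exact map_bindPi measurable_sumSubOnePos_prod measurable_sumSubOnePos measurable_snd
      fun _ _ => rfl

/-- Since `(· - 1)⁺` is monotone and 1-Lipschitz, the positive part of the difference is subadditive
over the `ν` children, at a cost of one factor `m` per step. -/
lemma lintegral_sub_coupledLaw_le {γ : Measure (ℝ × ℝ)} [IsProbabilityMeasure γ] (n : ℕ) :
    ∫⁻ z, ENNReal.ofReal (z.1 - z.2) ∂(coupledLaw ρ γ n) ≤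
      (∫⁻ k, (k : ℝ≥0∞) ∂ρ) ^ n * ∫⁻ z, ENNReal.ofReal (z.1 - z.2) ∂γ := by
  induction n with
  | zero => simp [coupledLaw]
  | succ n ih =>
    have := isProbabilityMeasure_coupledLaw (ρ := ρ) (γ := γ) n
    have hmeas : Measurable fun z : ℝ × ℝ => ENNReal.ofReal (z.1 - z.2) := by fun_prop
    rw [pow_succ', mul_assoc]
    refine le_trans ?_ (mul_le_mul_right ih _)
    rw [coupledLaw, lintegral_bindPi measurable_sumSubOnePos_prod hmeas,
      ← lintegral_mul_const _ (measurable_of_countable _)]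
    refine lintegral_mono fun k => ?_
    rw [← lintegral_pi_sum hmeas]
    refine lintegral_mono fun z => ?_
    refine le_trans ?_
      (Finset.le_sum_of_subadditive _ ENNReal.ofReal_zero.le (fun _ _ => ENNReal.ofReal_add_le) _ _)
    rw [Finset.sum_sub_distrib]
    rcases le_total (∑ i, (z i).1 - 1) 0 with h | h
    · rw [sumSubOnePos, max_eq_right h, ENNReal.ofReal_of_nonpos]
      · exact zero_le
      · simp [sumSubOnePos]
    · refine ENNReal.ofReal_le_ofReal ?_
      rw [sumSubOnePos, max_eq_left h]
      have := le_max_left (∑ i, (z i).2 - 1) 0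
      rw [sumSubOnePos]
      linarith

lemma posMean_law_le_truncated [IsProbabilityMeasure η] (hp0 : 0 ≤ p) (hp1 : p ≤ 1) {L : ℝ}
    (hL : 0 ≤ L) (n : ℕ) :
    posMean (law ρ η p n) ≤ posMean (law ρ (η.map fun x => min x L) p n) +
      (∫⁻ k, (k : ℝ≥0∞) ∂ρ) ^ n * (ENNReal.ofReal p * ∫⁻ x, ENNReal.ofReal (x - L) ∂η) := by
  have hprob := isProbabilityMeasure_initialLaw (η := η) hp0 hp1
  have hf : Measurable fun x : ℝ => (x, min x L) := by fun_prop
  have hmin : Measurable fun x : ℝ => min x L := by fun_prop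
  set γ := (initialLaw η p).map fun x => (x, min x L) with hγ
  have : IsProbabilityMeasure γ := Measure.isProbabilityMeasure_map hf.aemeasurable
  have h1 : γ.map Prod.fst = initialLaw η p := by
    rw [hγ, Measure.map_map measurable_fst hf]
    exact Measure.map_id
  have h2 : γ.map Prod.snd = initialLaw (η.map fun x => min x L) p := by
    rw [hγ, Measure.map_map measurable_snd hf, ← map_initialLaw hmin (min_eq_left hL)]
    rfl
  have hmeas : Measurable fun z : ℝ × ℝ => ENNReal.ofReal (z.1 - z.2) := by fun_prop
  have h3 : ∫⁻ z, ENNReal.ofReal (z.1 - z.2) ∂γ =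
      ENNReal.ofReal p * ∫⁻ x, ENNReal.ofReal (x - L) ∂η := by
    rw [hγ, lintegral_map hmeas hf, lintegral_initialLaw (by fun_prop)]
    simp only [min_eq_left hL, sub_zero, ENNReal.ofReal_zero, mul_zero, zero_add]
    congr 1
    refine lintegral_congr fun x => ?_
    rcases le_total x L with h | h
    · rw [min_eq_left h, sub_self, ENNReal.ofReal_zero, ENNReal.ofReal_of_nonpos (by linarith)]
    · rw [min_eq_right h]
  rw [← h3, ← map_fst_coupledLaw h1, ← map_snd_coupledLaw h2, posMean, posMean,
    lintegral_map ENNReal.measurable_ofReal measurable_fst,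
    lintegral_map ENNReal.measurable_ofReal measurable_snd]
  refine le_trans ?_ (add_le_add_right (lintegral_sub_coupledLaw_le n) _)
  rw [← lintegral_add_right _ hmeas]
  refine lintegral_mono fun z => ?_
  refine le_trans (le_of_eq ?_) ENNReal.ofReal_add_le
  ring_nf

end Law

/-! ### Iterating the exponential moment and the tail. -/

section Moments

variable {ρ : Measure ℕ} {η μ : Measure ℝ} {p : ℝ}

lemma posMean_le_expMoment {s : ℝ} (hs : 0 < s) (μ : Measure ℝ) :
    posMean μ ≤ ENNReal.ofReal s⁻¹ * expMoment s μ := by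
  rw [posMean, expMoment, ← lintegral_const_mul _ (by fun_prop)]
  refine lintegral_mono fun x => ?_
  rw [← ENNReal.ofReal_mul (by positivity)]
  refine ENNReal.ofReal_le_ofReal ?_
  rw [inv_mul_eq_div, le_div_iff₀ hs]
  have h1 := Real.add_one_le_exp (s * max x 0)
  have h2 := mul_le_mul_of_nonneg_left (le_max_left x 0) hs.le
  linarith

/-- Split `s = (s - θ) + θ` and bound the truncated value by `L` in the first part, by `x⁺` in the
second. -/
lemma expMoment_map_min_le {s θ L : ℝ} (hθ : 0 ≤ θ) (hs : θ ≤ s) (hL : 0 ≤ L) (η : Measure ℝ) :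
    expMoment s (η.map fun x => min x L) ≤
      ENNReal.ofReal (Real.exp ((s - θ) * L)) * expMoment θ η := by
  rw [expMoment, lintegral_map (by fun_prop) (by fun_prop), expMoment,
    ← lintegral_const_mul _ (by fun_prop)]
  refine lintegral_mono fun x => ?_
  rw [← ENNReal.ofReal_mul (by positivity), ← Real.exp_add]
  refine ENNReal.ofReal_le_ofReal (Real.exp_le_exp.2 ?_)
  have h1 : max (min x L) 0 ≤ L := max_le (min_le_right _ _) hL
  have h2 : max (min x L) 0 ≤ max x 0 := max_le_max_right _ (min_le_left _ _)
  have h3 := mul_le_mul_of_nonneg_left h1 (sub_nonneg.2 hs)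
  have h4 := mul_le_mul_of_nonneg_left h2 hθ
  linarith

lemma lintegral_ofReal_sub_le {θ : ℝ} (hθ : 0 < θ) (L : ℝ) (η : Measure ℝ) :
    ∫⁻ x, ENNReal.ofReal (x - L) ∂η ≤
      ENNReal.ofReal (θ⁻¹ * Real.exp (-θ * L)) * expMoment θ η := by
  rw [expMoment, ← lintegral_const_mul _ (by fun_prop)]
  refine lintegral_mono fun x => ?_
  rw [← ENNReal.ofReal_mul (by positivity)]
  refine ENNReal.ofReal_le_ofReal ?_
  rw [mul_assoc, ← Real.exp_add, inv_mul_eq_div, le_div_iff₀ hθ]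
  have h1 := Real.add_one_le_exp (-θ * L + θ * max x 0)
  have h2 := mul_le_mul_of_nonneg_left (le_max_left x 0) hθ.le
  linarith

lemma expMoment_initialLaw_le [IsProbabilityMeasure η] (hp0 : 0 ≤ p) (s : ℝ) :
    expMoment s (initialLaw η p) ≤ 1 + ENNReal.ofReal p * expMoment s η := by
  rw [expMoment, lintegral_initialLaw (by fun_prop)]
  refine add_le_add ?_ le_rfl
  simp [hp0]

/-- The level `1 + δ` is invariant: `1 - e^{-s} + e^{-s} (1 + e^s δ) = 1 + δ`. -/
lemma expMoment_law_le [IsProbabilityMeasure ρ] [IsProbabilityMeasure η] (hp0 : 0 ≤ p)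
    (hp1 : p ≤ 1) {s δ : ℝ} (hs : 0 ≤ s) (hδ : 0 ≤ δ)
    (hρ : ∫⁻ k, ENNReal.ofReal (1 + δ) ^ k ∂ρ ≤ ENNReal.ofReal (1 + Real.exp s * δ))
    (h0 : expMoment s (initialLaw η p) ≤ ENNReal.ofReal (1 + δ)) (n : ℕ) :
    expMoment s (law ρ η p n) ≤ ENNReal.ofReal (1 + δ) := by
  induction n with
  | zero => exact h0
  | succ n ih =>
    have := isProbabilityMeasure_law (ρ := ρ) (η := η) hp0 hp1 n
    refine (expMoment_step_le hs).trans ?_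
    have h1 : ∫⁻ k, expMoment s (law ρ η p n) ^ k ∂ρ ≤ ENNReal.ofReal (1 + Real.exp s * δ) :=
      (lintegral_mono fun k => pow_le_pow_left' ih k).trans hρ
    refine (add_le_add_right (mul_le_mul_right h1 _) _).trans ?_
    rw [← ENNReal.ofReal_mul (by positivity),
      ← ENNReal.ofReal_add (by simpa using hs) (by positivity)]
    refine ENNReal.ofReal_le_ofReal (le_of_eq ?_)
    have hexp : Real.exp (-s) * Real.exp s = 1 := by rw [← Real.exp_add]; simp
    linear_combination δ * hexp

/-- Each step back in time raises the threshold by `1` and divides the tail by `r`; the cap `δ`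
keeps the tail where the linear bound on the generating function holds. -/
lemma law_Iio_le [IsProbabilityMeasure ρ] [IsProbabilityMeasure η] (hη : ∀ᵐ x ∂η, 0 ≤ x)
    (hp0 : 0 ≤ p) (hp1 : p ≤ 1) {r δ : ℝ} (hr : 1 ≤ r) (hδ : 0 < δ)
    (hρ : ∀ q, 0 ≤ q → q ≤ δ → ∫⁻ k, ENNReal.ofReal (1 - q) ^ k ∂ρ ≤ ENNReal.ofReal (1 - r * q))
    {q : ℝ} (hq : 0 ≤ q) (n : ℕ) (x : ℝ)
    (h0 : initialLaw η p (Set.Iio (x + n)) ≤ ENNReal.ofReal (1 - q)) :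
    law ρ η p n (Set.Iio x) ≤ ENNReal.ofReal (1 - min (r ^ n * q) δ) := by
  induction n generalizing x with
  | zero =>
    refine le_trans (by simpa [law] using h0) (ENNReal.ofReal_le_ofReal ?_)
    have := min_le_left (r ^ 0 * q) δ
    simp only [pow_zero, one_mul] at this ⊢
    linarith
  | succ n ih =>
    have := isProbabilityMeasure_law (ρ := ρ) (η := η) hp0 hp1 n
    refine (step_Iio_le (ae_nonneg_law hη n) x).trans ?_
    have h1 := ih (x + 1) (by rw [add_assoc, add_comm (1 : ℝ)]; exact_mod_cast h0)
    refine ((lintegral_mono fun k => pow_le_pow_left' h1 k).trans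
      (hρ _ (le_min (by positivity) hδ.le) (min_le_right _ _))).trans
      (ENNReal.ofReal_le_ofReal (sub_le_sub_left ?_ _))
    rw [mul_min_of_nonneg _ _ (by linarith), pow_succ', mul_assoc]
    exact min_le_min_left _ (by nlinarith)

lemma ofReal_mul_le_posMean [IsProbabilityMeasure μ] {x q : ℝ} (hx : 0 < x) (hq1 : q ≤ 1)
    (h : μ (Set.Iio x) ≤ ENNReal.ofReal (1 - q)) : ENNReal.ofReal (x * q) ≤ posMean μ := by
  have h1 : ENNReal.ofReal q ≤ μ (Set.Ici x) := by
    rw [← Set.compl_Iio, prob_compl_eq_one_sub measurableSet_Iio]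
    refine le_trans ?_ (tsub_le_tsub_left h 1)
    rw [← ENNReal.ofReal_one]
    rw [← ENNReal.ofReal_sub _ (by linarith), sub_sub_cancel]
  rw [ENNReal.ofReal_mul hx.le]
  refine (mul_le_mul_right h1 _).trans (le_trans (mul_le_mul_right (measure_mono ?_) _)
    (mul_meas_ge_le_lintegral ENNReal.measurable_ofReal _))
  intro y hy
  exact ENNReal.ofReal_le_ofReal hy

end Moments

/-! ### Existence of the limit and a criterion for its positivity. -/

section FreeEnergy

lemma integral_law {ρ : Measure ℕ} {η : Measure ℝ} {p : ℝ} (hη : ∀ᵐ x ∂η, 0 ≤ x) (n : ℕ) :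
    ∫ x, x ∂(law ρ η p n) = (posMean (law ρ η p n)).toReal :=
  integral_eq_lintegral_of_nonneg_ae (ae_nonneg_law hη n) measurable_id.aestronglyMeasurable

variable {ρ : Measure ℕ} [IsProbabilityMeasure ρ] {η : Measure ℝ} [IsProbabilityMeasure η] {p : ℝ}

lemma posMean_law_ne_top (hρ : Integrable (fun k : ℕ => (k : ℝ)) ρ) (hη' : posMean η ≠ ∞)
    (hp0 : 0 ≤ p) (hp1 : p ≤ 1) (n : ℕ) : posMean (law ρ η p n) ≠ ∞ := by
  induction n with
  | zero =>
    rw [law, posMean, lintegral_initialLaw ENNReal.measurable_ofReal, ← posMean]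
    simpa using ENNReal.mul_ne_top (ENNReal.ofReal_ne_top (r := p)) hη'
  | succ n ih =>
    have := isProbabilityMeasure_law (ρ := ρ) (η := η) hp0 hp1 n
    refine ne_top_of_le_ne_top (ENNReal.mul_ne_top ?_ ih) posMean_step_le
    rw [lintegral_natCast hρ]
    exact ENNReal.ofReal_ne_top

lemma integrable_law (hρ : Integrable (fun k : ℕ => (k : ℝ)) ρ) (hη : ∀ᵐ x ∂η, 0 ≤ x)
    (hη' : posMean η ≠ ∞) (hp0 : 0 ≤ p) (hp1 : p ≤ 1) (n : ℕ) :
    Integrable (fun x : ℝ => x) (law ρ η p n) :=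
  (lintegral_ofReal_ne_top_iff_integrable measurable_id.aestronglyMeasurable
    (ae_nonneg_law hη n)).1 (posMean_law_ne_top hρ hη' hp0 hp1 n)

lemma integral_law_succ_le (hρ : Integrable (fun k : ℕ => (k : ℝ)) ρ)
    (hm : 1 < offspringMean ρ) (hη : ∀ᵐ x ∂η, 0 ≤ x) (hη' : posMean η ≠ ∞)
    (hp0 : 0 ≤ p) (hp1 : p ≤ 1) (n : ℕ) :
    ∫ x, x ∂(law ρ η p (n + 1)) ≤ offspringMean ρ * ∫ x, x ∂(law ρ η p n) := by
  have := isProbabilityMeasure_law (ρ := ρ) (η := η) hp0 hp1 n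
  have hfin := posMean_law_ne_top hρ hη' hp0 hp1 n
  have h := posMean_step_le (ρ := ρ) (μ := law ρ η p n)
  rw [lintegral_natCast hρ] at h
  rw [integral_law hη, integral_law hη]
  have h2 := ENNReal.toReal_mono (ENNReal.mul_ne_top ENNReal.ofReal_ne_top hfin) h
  rwa [ENNReal.toReal_mul, ENNReal.toReal_ofReal (by linarith)] at h2

lemma le_integral_law_succ (hρ : Integrable (fun k : ℕ => (k : ℝ)) ρ)
    (hm : 1 < offspringMean ρ) (hη : ∀ᵐ x ∂η, 0 ≤ x) (hη' : posMean η ≠ ∞)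
    (hp0 : 0 ≤ p) (hp1 : p ≤ 1) (n : ℕ) :
    offspringMean ρ * ∫ x, x ∂(law ρ η p n) - 1 ≤ ∫ x, x ∂(law ρ η p (n + 1)) := by
  have := isProbabilityMeasure_law (ρ := ρ) (η := η) hp0 hp1 n
  have hfin := posMean_law_ne_top hρ hη' hp0 hp1 (n + 1)
  have h := le_posMean_step_add_one (ρ := ρ) (ae_nonneg_law (ρ := ρ) (p := p) hη n)
  rw [lintegral_natCast hρ] at h
  rw [integral_law hη, integral_law hη]
  have h2 := ENNReal.toReal_mono (ENNReal.add_ne_top.2 ⟨hfin, ENNReal.one_ne_top⟩) h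
  rw [ENNReal.toReal_mul, ENNReal.toReal_ofReal (by linarith),
    ENNReal.toReal_add hfin ENNReal.one_ne_top, ENNReal.toReal_one] at h2
  exact sub_le_iff_le_add.2 h2

lemma tendsto_normalizedMean (hρ : Integrable (fun k : ℕ => (k : ℝ)) ρ)
    (hm : 1 < offspringMean ρ) (hη : ∀ᵐ x ∂η, 0 ≤ x) (hη' : posMean η ≠ ∞)
    (hp0 : 0 ≤ p) (hp1 : p ≤ 1) :
    Tendsto (normalizedMean ρ η p) atTop (𝓝 (freeEnergy ρ η p)) := by
  have hanti : Antitone (normalizedMean ρ η p) := antitone_nat_of_succ_le fun n => by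
    have h := integral_law_succ_le hρ hm hη hη' hp0 hp1 n
    have hpos : 0 < offspringMean ρ := by linarith
    rw [normalizedMean, normalizedMean, div_le_div_iff₀ (by positivity) (by positivity), pow_succ']
    nlinarith [pow_pos hpos n]
  have hbdd : BddBelow (Set.range (normalizedMean ρ η p)) := by
    refine ⟨0, ?_⟩
    rintro _ ⟨n, rfl⟩
    exact div_nonneg (integral_law (ρ := ρ) (p := p) hη n ▸ ENNReal.toReal_nonneg)
      (pow_nonneg (by linarith) n)
  exact tendsto_nhds_limUnder ⟨_, tendsto_atTop_ciInf hanti hbdd⟩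

lemma le_freeEnergy_of_le_integral (hρ : Integrable (fun k : ℕ => (k : ℝ)) ρ)
    (hm : 1 < offspringMean ρ) (hη : ∀ᵐ x ∂η, 0 ≤ x) (hη' : posMean η ≠ ∞)
    (hp0 : 0 ≤ p) (hp1 : p ≤ 1) {n : ℕ}
    (h : 1 / (offspringMean ρ - 1) + 1 ≤ ∫ x, x ∂(law ρ η p n)) :
    1 / offspringMean ρ ^ n ≤ freeEnergy ρ η p := by
  set m := offspringMean ρ
  have hpos : 0 < m := by linarith
  have hm1 : m - 1 ≠ 0 := by linarith
  -- `1 / (m - 1)` is the fixed point of `a ↦ m a - 1`, the worst case for the mean in one step.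
  have hmono : Monotone fun n => (∫ x, x ∂(law ρ η p n) - 1 / (m - 1)) / m ^ n :=
    monotone_nat_of_le_succ fun n => by
      have h := le_integral_law_succ hρ hm hη hη' hp0 hp1 n
      rw [div_le_div_iff₀ (by positivity) (by positivity), pow_succ', ← mul_assoc]
      refine mul_le_mul_of_nonneg_right ?_ (by positivity)
      have : 1 / (m - 1) * m = 1 / (m - 1) + 1 := by field_simp; ring
      linarith
  have hlim : Tendsto (fun n => (∫ x, x ∂(law ρ η p n) - 1 / (m - 1)) / m ^ n) atTop
      (𝓝 (freeEnergy ρ η p)) := by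
    have h1 : Tendsto (fun n : ℕ => 1 / (m - 1) / m ^ n) atTop (𝓝 0) :=
      tendsto_const_nhds.div_atTop (tendsto_pow_atTop_atTop_of_one_lt hm)
    simpa [normalizedMean, sub_div] using (tendsto_normalizedMean hρ hm hη hη' hp0 hp1).sub h1
  refine le_trans ?_ (hmono.ge_of_tendsto hlim n)
  exact div_le_div_of_nonneg_right (by linarith) (by positivity)

end FreeEnergy

/-! ### Power bounds on the free energy as `p ↓ 0`. -/

section Asymptotics

variable {ρ : Measure ℕ} [IsProbabilityMeasure ρ] {η : Measure ℝ} [IsProbabilityMeasure η]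

lemma expMoment_ne_top_of_tail {θ θ' c x₀ : ℝ} (hθ : 0 < θ) (hθ' : 0 ≤ θ') (hlt : θ' < θ)
    (hη : ∀ x, x₀ ≤ x → η.real (Set.Ici x) ≤ c * Real.exp (-θ * x)) : expMoment θ' η ≠ ∞ := by
  -- The second term makes the bound at least `1`, hence trivial, for `n ≤ x₀`.
  set C := max c (Real.exp (θ * x₀))
  have hC : 0 ≤ C := (Real.exp_pos _).le.trans (le_max_right _ _)
  have htail (n : ℕ) : η.real (Set.Ici (n : ℝ)) ≤ C * Real.exp (-θ * n) := by
    rcases le_total x₀ n with h | h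
    · exact (hη n h).trans (mul_le_mul_of_nonneg_right (le_max_left _ _) (Real.exp_pos _).le)
    · refine measureReal_le_one.trans (le_trans ?_
        (mul_le_mul_of_nonneg_right (le_max_right _ _) (Real.exp_pos _).le))
      rw [← Real.exp_add, Real.one_le_exp_iff]
      nlinarith
  have hpt (x : ℝ) : ENNReal.ofReal (Real.exp (θ' * max x 0)) ≤ 1 + ∑' n : ℕ,
      ENNReal.ofReal (Real.exp (θ' * (n + 1))) * (Set.Ici (n : ℝ)).indicator 1 x := by
    rcases le_total x 0 with h | h
    · simp [max_eq_right h]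
    · refine le_trans ?_ (le_add_of_nonneg_left zero_le)
      refine le_trans ?_ (ENNReal.le_tsum ⌊x⌋₊)
      rw [Set.indicator_of_mem (Set.mem_Ici.2 (Nat.floor_le h)), max_eq_left h, Pi.one_apply,
        mul_one]
      exact ENNReal.ofReal_le_ofReal (Real.exp_le_exp.2
        (mul_le_mul_of_nonneg_left (Nat.lt_floor_add_one x).le hθ'))
  have hsum : Summable fun n : ℕ => C * Real.exp θ' * Real.exp (-(θ - θ')) ^ n :=
    (summable_geometric_of_lt_one (Real.exp_pos _).le
      (by simpa using hlt)).mul_left _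
  refine ne_top_of_le_ne_top (ENNReal.add_ne_top.2 ⟨ENNReal.one_ne_top, hsum.tsum_ofReal_ne_top⟩)
    ((lintegral_mono hpt).trans ?_)
  rw [lintegral_add_left measurable_const, lintegral_tsum fun n =>
    ((measurable_one.indicator measurableSet_Ici).const_mul _).aemeasurable]
  simp only [lintegral_const, measure_univ, mul_one]
  refine add_le_add le_rfl (ENNReal.tsum_le_tsum fun n => ?_)
  rw [lintegral_const_mul _ (measurable_one.indicator measurableSet_Ici),
    lintegral_indicator_one measurableSet_Ici, ← ofReal_measureReal,
    ← ENNReal.ofReal_mul (Real.exp_pos _).le]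
  refine ENNReal.ofReal_le_ofReal
    ((mul_le_mul_of_nonneg_left (htail n) (Real.exp_pos _).le).trans (le_of_eq ?_))
  rw [← Real.exp_nat_mul, mul_left_comm, ← Real.exp_add, mul_assoc, ← Real.exp_add]
  ring_nf

lemma eventually_mul_rpow_le {c : ℝ} (hc : 0 < c) (K : ℝ) {δ : ℝ} (hδ : 0 < δ) :
    ∀ᶠ p : ℝ in 𝓝[>] 0, K * p ^ c ≤ δ := by
  have h : Tendsto (fun p : ℝ => K * p ^ c) (𝓝 0) (𝓝 (K * 0 ^ c)) :=
    ((Real.continuousAt_rpow_const 0 c (Or.inr hc.le)).tendsto).const_mul K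
  rw [Real.zero_rpow hc.ne', mul_zero] at h
  exact ((h.eventually (gt_mem_nhds hδ)).mono fun p hp => hp.le).filter_mono nhdsWithin_le_nhds

lemma exists_freeEnergy_le {d : ℝ} (hd : 0 < d) (hρ : Integrable (fun k : ℕ => (1 + d) ^ k) ρ)
    (hm : 1 < offspringMean ρ) (hη : ∀ᵐ x ∂η, 0 ≤ x) {θ s a : ℝ} (hθ : 0 < θ) (hθs : θ ≤ s)
    (hs : Real.log (offspringMean ρ) < s) (ha : 0 ≤ a) (has : a * (s - θ) < 1)
    (hexp : expMoment θ η ≠ ∞) :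
    ∃ C : ℝ, ∀ᶠ p : ℝ in 𝓝[>] 0, freeEnergy ρ η p ≤ C * p ^ (1 + θ * a) := by
  have hk := integrable_natCast_of_pow hd hρ
  have hmpos : 0 < offspringMean ρ := by linarith
  have hspos : 0 < s := by linarith
  have hη' : posMean η ≠ ∞ := ne_top_of_le_ne_top
    (ENNReal.mul_ne_top ENNReal.ofReal_ne_top hexp) (posMean_le_expMoment hθ η)
  obtain ⟨δ, hδ, hδρ⟩ := exists_lintegral_one_add_pow_le hd hρ
    ((Real.log_lt_iff_lt_exp hmpos).1 hs)
  set K := (expMoment θ η).toReal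
  have hK : expMoment θ η = ENNReal.ofReal K := (ENNReal.ofReal_toReal hexp).symm
  have hK0 : 0 ≤ K := ENNReal.toReal_nonneg
  refine ⟨θ⁻¹ * K, ?_⟩
  filter_upwards [eventually_mul_rpow_le (sub_pos.2 has) K hδ, self_mem_nhdsWithin,
    nhdsWithin_le_nhds (gt_mem_nhds one_pos)] with p hpK (hp : 0 < p) hp1
  -- With this choice `e^{x L} = p ^ (-a x)`: the initial excess is at most `K p ^ (1 - a (s - θ))`,
  -- and the truncation error is of order `p ^ (1 + θ a)`.
  set L := -a * Real.log p
  have hL : 0 ≤ L := by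
    have := Real.log_neg hp hp1
    simp only [L]
    nlinarith
  have hmin : Measurable fun x : ℝ => min x L := by fun_prop
  have := Measure.isProbabilityMeasure_map (μ := η) hmin.aemeasurable
  have hrpow (x : ℝ) : Real.exp (x * L) = p ^ (-a * x) := by
    rw [Real.rpow_def_of_pos hp]
    congr 1
    ring
  have h0 : expMoment s (initialLaw (η.map fun x => min x L) p) ≤ ENNReal.ofReal (1 + δ) := by
    refine (expMoment_initialLaw_le hp.le s).trans ?_
    rw [ENNReal.ofReal_add zero_le_one hδ.le, ENNReal.ofReal_one]
    refine add_le_add le_rfl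
      ((mul_le_mul_right (expMoment_map_min_le hθ.le hθs hL η) _).trans ?_)
    rw [hK, ← ENNReal.ofReal_mul (by positivity), ← ENNReal.ofReal_mul hp.le]
    refine ENNReal.ofReal_le_ofReal (le_of_eq_of_le ?_ hpK)
    rw [hrpow, mul_comm, mul_comm _ K, mul_assoc]
    congr 1
    rw [mul_comm]
    nth_rw 1 [← Real.rpow_one p]
    rw [← Real.rpow_add hp]
    ring_nf
  set D := θ⁻¹ * K * p ^ (1 + θ * a) with hD
  have hD0 : 0 ≤ D := by positivity
  set B := s⁻¹ * (1 + δ)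
  have hB0 : 0 ≤ B := by positivity
  have hbound (n : ℕ) : normalizedMean ρ η p n ≤ B / offspringMean ρ ^ n + D := by
    have h1 := posMean_law_le_truncated (ρ := ρ) (η := η) hp.le hp1.le hL n
    have h2 : posMean (law ρ (η.map fun x => min x L) p n) ≤ ENNReal.ofReal B := by
      refine (posMean_le_expMoment hspos _).trans ?_
      rw [ENNReal.ofReal_mul (by positivity)]
      exact mul_le_mul_right (expMoment_law_le hp.le hp1.le hspos.le hδ.le hδρ h0 n) _
    have h3 : ENNReal.ofReal p * ∫⁻ x, ENNReal.ofReal (x - L) ∂η ≤ ENNReal.ofReal D := by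
      refine (mul_le_mul_right (lintegral_ofReal_sub_le hθ L η) _).trans (le_of_eq ?_)
      rw [hK, ← ENNReal.ofReal_mul (by positivity), ← ENNReal.ofReal_mul hp.le, hrpow, hD,
        Real.rpow_add hp, Real.rpow_one]
      ring_nf
    have h4 : posMean (law ρ η p n) ≤ ENNReal.ofReal (B + offspringMean ρ ^ n * D) := by
      rw [ENNReal.ofReal_add hB0 (by positivity),
        ENNReal.ofReal_mul (p := offspringMean ρ ^ n) (by positivity),
        ENNReal.ofReal_pow hmpos.le, ← lintegral_natCast hk]
      exact h1.trans (add_le_add h2 (mul_le_mul_right h3 _))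
    have h5 := ENNReal.toReal_le_of_le_ofReal (by positivity) h4
    rw [normalizedMean, integral_law hη, div_le_iff₀ (by positivity), add_mul,
      div_mul_cancel₀ _ (by positivity)]
    linarith
  have hlim : Tendsto (fun n : ℕ => B / offspringMean ρ ^ n + D) atTop (𝓝 (0 + D)) :=
    (tendsto_const_nhds.div_atTop (tendsto_pow_atTop_atTop_of_one_lt hm)).add_const D
  rw [zero_add] at hlim
  exact le_of_tendsto_of_tendsto' (tendsto_normalizedMean hk hm hη hη' hp.le hp1.le) hlim hbound

lemma exists_le_freeEnergy {d : ℝ} (hd : 0 < d) (hρ : Integrable (fun k : ℕ => (1 + d) ^ k) ρ)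
    (hm : 1 < offspringMean ρ) (hη : ∀ᵐ x ∂η, 0 ≤ x) (hη' : posMean η ≠ ∞) {θ w c x₀ : ℝ}
    (hθ : 0 < θ) (hθw : θ < w) (hw : w < Real.log (offspringMean ρ)) (hc : 0 < c)
    (htail : ∀ x, x₀ ≤ x → c * Real.exp (-θ * x) ≤ η.real (Set.Ici x)) :
    ∃ C : ℝ, 0 < C ∧ ∀ᶠ p : ℝ in 𝓝[>] 0,
      C * p ^ (Real.log (offspringMean ρ) / (w - θ)) ≤ freeEnergy ρ η p := by
  have hk := integrable_natCast_of_pow hd hρ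
  set m := offspringMean ρ
  have hmpos : 0 < m := by linarith
  have hwθ : 0 < w - θ := by linarith
  obtain ⟨δ, hδ, hδ1, hδρ⟩ := exists_forall_lintegral_one_sub_pow_le hd hρ
    ((Real.lt_log_iff_exp_lt hmpos).1 hw)
  have hM : 0 < 1 / (m - 1) + 1 := by
    have : 0 < m - 1 := by linarith
    positivity
  -- So large that a tail of mass `δ` above `x` forces a mean of at least `1 / (m - 1) + 1`.
  set x := max x₀ ((1 / (m - 1) + 1) / δ)
  have hx : 0 < x := lt_max_of_lt_right (by positivity)
  have hxδ : 1 / (m - 1) + 1 ≤ x * δ := (div_le_iff₀ hδ).1 (le_max_right _ _)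
  -- The tail reaches `δ` after `n` steps exactly when `n (w - θ) ≥ A - log p`.
  set A := Real.log (δ * Real.exp (θ * x) / c)
  have hA : Real.exp A = δ * Real.exp (θ * x) / c := Real.exp_log (by positivity)
  -- The constant pays for the shift `A` and for rounding `n` up.
  refine ⟨Real.exp (-(Real.log m * (A / (w - θ) + 1))), Real.exp_pos _, ?_⟩
  filter_upwards [self_mem_nhdsWithin, nhdsWithin_le_nhds (gt_mem_nhds one_pos),
    nhdsWithin_le_nhds (gt_mem_nhds (Real.exp_pos A))] with p (hp : 0 < p) hp1 hpA
  have hlogp : Real.log p < A := (Real.log_lt_iff_lt_exp hp).2 hpA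
  set n := ⌈(A - Real.log p) / (w - θ)⌉₊
  have hn1 : (A - Real.log p) ≤ n * (w - θ) := (div_le_iff₀ hwθ).1 (Nat.le_ceil _)
  have hn2 : (n : ℝ) ≤ (A - Real.log p) / (w - θ) + 1 :=
    (Nat.ceil_lt_add_one (div_nonneg (by linarith) hwθ.le)).le
  set q := p * (c * Real.exp (-θ * (x + n)))
  have hq0 : 0 ≤ q := by positivity
  have hqn : δ ≤ Real.exp w ^ n * q := by
    have h1 : Real.exp w ^ n * q =
        Real.exp (n * (w - θ)) * (p * (c * Real.exp (-(θ * x)))) := by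
      have : Real.exp (n * w) * Real.exp (-θ * (x + n)) =
          Real.exp (n * (w - θ)) * Real.exp (-(θ * x)) := by
        rw [← Real.exp_add, ← Real.exp_add]
        ring_nf
      rw [← Real.exp_nat_mul]
      linear_combination p * c * this
    have h2 : δ = Real.exp (A - Real.log p) * (p * (c * Real.exp (-(θ * x)))) := by
      rw [Real.exp_sub, Real.exp_log hp, hA, Real.exp_neg]
      field_simp
    rw [h1]
    nth_rw 1 [h2]
    exact mul_le_mul_of_nonneg_right (Real.exp_le_exp.2 hn1) (by positivity)
  have h0 : initialLaw η p (Set.Iio (x + n)) ≤ ENNReal.ofReal (1 - q) := by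
    have h1 : η (Set.Iio (x + n)) ≤ ENNReal.ofReal (1 - c * Real.exp (-θ * (x + n))) := by
      rw [← ofReal_measureReal, ← Set.compl_Ici, probReal_compl_eq_one_sub measurableSet_Ici]
      refine ENNReal.ofReal_le_ofReal (sub_le_sub_left (htail _ ?_) _)
      exact (le_max_left _ _).trans (le_add_of_nonneg_right (Nat.cast_nonneg n))
    have h2 : 0 ≤ 1 - c * Real.exp (-θ * (x + n)) := by
      have := htail (x + n) ((le_max_left _ _).trans (le_add_of_nonneg_right (Nat.cast_nonneg n)))
      linarith [measureReal_le_one (μ := η) (s := Set.Ici (x + n))]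
    rw [initialLaw, Measure.add_apply, Measure.smul_apply, Measure.smul_apply, smul_eq_mul,
      smul_eq_mul]
    refine (add_le_add (mul_le_mul_right prob_le_one _) (mul_le_mul_right h1 _)).trans ?_
    rw [mul_one, ← ENNReal.ofReal_mul hp.le, ← ENNReal.ofReal_add (by linarith) (by positivity)]
    refine ENNReal.ofReal_le_ofReal (le_of_eq ?_)
    simp only [q]
    ring
  have := isProbabilityMeasure_law (ρ := ρ) (η := η) hp.le hp1.le n
  have h1 := law_Iio_le hη hp.le hp1.le (Real.one_le_exp (by linarith)) hδ hδρ hq0 n x h0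
  rw [min_eq_right hqn] at h1
  have h2 := ofReal_mul_le_posMean hx hδ1 h1
  have h3 : 1 / (m - 1) + 1 ≤ ∫ x, x ∂(law ρ η p n) := by
    rw [integral_law hη]
    exact hxδ.trans ((ENNReal.ofReal_le_iff_le_toReal
      (posMean_law_ne_top hk hη' hp.le hp1.le n)).1 h2)
  refine le_trans ?_ (le_freeEnergy_of_le_integral hk hm hη hη' hp.le hp1.le h3)
  have hmn : 1 / m ^ n = Real.exp (-(Real.log m * n)) := by
    rw [Real.exp_neg, mul_comm, Real.exp_nat_mul, Real.exp_log hmpos, one_div]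
  rw [hmn, Real.rpow_def_of_pos hp, ← Real.exp_add]
  refine Real.exp_le_exp.2 ?_
  have hlogm := Real.log_pos hm
  have := mul_le_mul_of_nonneg_left hn2 hlogm.le
  have heq : Real.log p * (Real.log m / (w - θ)) = Real.log m * (Real.log p / (w - θ)) := by ring
  rw [heq]
  rw [sub_div] at this
  linarith

lemma eventually_freeEnergy_le_rpow {d : ℝ} (hd : 0 < d)
    (hρ : Integrable (fun k : ℕ => (1 + d) ^ k) ρ) (hm : 1 < offspringMean ρ)
    (hη : ∀ᵐ x ∂η, 0 ≤ x) {θ c x₀ : ℝ} (hθ : 0 < θ) (hθm : θ < Real.log (offspringMean ρ))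
    (htail : ∀ x, x₀ ≤ x → η.real (Set.Ici x) ≤ c * Real.exp (-θ * x)) {b : ℝ}
    (hb : b < Real.log (offspringMean ρ) / (Real.log (offspringMean ρ) - θ)) :
    ∀ᶠ p : ℝ in 𝓝[>] 0, freeEnergy ρ η p ≤ p ^ b := by
  set l := Real.log (offspringMean ρ)
  have hlθ : 0 < l - θ := by linarith
  -- The `θ`-moment itself may diverge, so the moment `θ - κ` is used with `s = l + κ`. Their gap is
  -- `l - θ + 2κ`, and `3κ` in the denominator makes `a (s - θ') < 1` strict, where `θ' = θ - κ`.
  have hcont : Tendsto (fun κ : ℝ => 1 + (θ - κ) * (1 / (l - θ + 3 * κ))) (𝓝[>] 0)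
      (𝓝 (1 + (θ - 0) * (1 / (l - θ + 3 * 0)))) := by
    have : ContinuousAt (fun κ : ℝ => 1 + (θ - κ) * (1 / (l - θ + 3 * κ))) 0 := by
      have : l - θ + 3 * 0 ≠ 0 := by simpa using hlθ.ne'
      fun_prop (disch := assumption)
    exact this.tendsto.mono_left nhdsWithin_le_nhds
  have hval : 1 + (θ - 0) * (1 / (l - θ + 3 * 0)) = l / (l - θ) := by
    field_simp
    ring
  rw [hval] at hcont
  obtain ⟨κ, hbκ, hκθ, hκ : 0 < κ⟩ := ((hcont.eventually (lt_mem_nhds hb)).and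
    ((eventually_nhdsWithin_of_eventually_nhds (gt_mem_nhds hθ)).and self_mem_nhdsWithin)).exists
  set a := 1 / (l - θ + 3 * κ)
  have hden : 0 < l - θ + 3 * κ := by linarith
  have ha : 0 ≤ a := by positivity
  have has : a * (l + κ - (θ - κ)) < 1 := by
    rw [one_div_mul_eq_div, div_lt_one hden]
    linarith
  obtain ⟨C, hC⟩ := exists_freeEnergy_le hd hρ hm hη (θ := θ - κ) (s := l + κ) (a := a)
    (by linarith) (by linarith) (by linarith) ha has
    (expMoment_ne_top_of_tail hθ (by linarith) (by linarith) htail)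
  filter_upwards [hC, eventually_mul_rpow_le (sub_pos.2 hbκ) C one_pos, self_mem_nhdsWithin]
    with p hp1 hp2 (hp : 0 < p)
  refine hp1.trans ?_
  have h : p ^ (1 + (θ - κ) * a) = p ^ (1 + (θ - κ) * a - b) * p ^ b := by
    rw [← Real.rpow_add hp, sub_add_cancel]
  rw [h, ← mul_assoc]
  exact mul_le_of_le_one_left (by positivity) hp2

lemma eventually_rpow_le_freeEnergy {d : ℝ} (hd : 0 < d)
    (hρ : Integrable (fun k : ℕ => (1 + d) ^ k) ρ) (hm : 1 < offspringMean ρ)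
    (hη : ∀ᵐ x ∂η, 0 ≤ x) (hη' : posMean η ≠ ∞) {θ c x₀ : ℝ} (hθ : 0 < θ)
    (hθm : θ < Real.log (offspringMean ρ)) (hc : 0 < c)
    (htail : ∀ x, x₀ ≤ x → c * Real.exp (-θ * x) ≤ η.real (Set.Ici x)) {b : ℝ}
    (hb : Real.log (offspringMean ρ) / (Real.log (offspringMean ρ) - θ) < b) :
    ∀ᶠ p : ℝ in 𝓝[>] 0, p ^ b ≤ freeEnergy ρ η p := by
  set l := Real.log (offspringMean ρ)
  have hlθ : 0 < l - θ := by linarith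
  have hcont : Tendsto (fun w : ℝ => l / (w - θ)) (𝓝[<] l) (𝓝 (l / (l - θ))) := by
    have : ContinuousAt (fun w : ℝ => l / (w - θ)) l := by
      have := hlθ.ne'
      fun_prop (disch := assumption)
    exact this.tendsto.mono_left nhdsWithin_le_nhds
  obtain ⟨w, hbw, hθw, hw : w < l⟩ := ((hcont.eventually (gt_mem_nhds hb)).and
    ((eventually_nhdsWithin_of_eventually_nhds (lt_mem_nhds hθm)).and self_mem_nhdsWithin)).exists
  obtain ⟨C, hC0, hC⟩ := exists_le_freeEnergy hd hρ hm hη hη' hθ hθw hw hc htail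
  filter_upwards [hC, eventually_mul_rpow_le (sub_pos.2 hbw) 1 hC0, self_mem_nhdsWithin]
    with p hp1 hp2 (hp : 0 < p)
  refine le_trans ?_ hp1
  have h : p ^ b = p ^ (b - l / (w - θ)) * p ^ (l / (w - θ)) := by
    rw [← Real.rpow_add hp, sub_add_cancel]
  rw [h]
  exact mul_le_mul_of_nonneg_right (by simpa using hp2) (by positivity)

end Asymptotics

lemma exists_exponent_of_eventually_rpow_bounds {F : ℝ → ℝ} {β : ℝ}
    (hlow : ∀ b, β < b → ∀ᶠ p : ℝ in 𝓝[>] 0, p ^ b ≤ F p)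
    (hupp : ∀ b, b < β → ∀ᶠ p : ℝ in 𝓝[>] 0, F p ≤ p ^ b) :
    ∃ ε : ℝ → ℝ, Tendsto ε (𝓝[>] 0) (𝓝 0) ∧ ∀ᶠ p : ℝ in 𝓝[>] 0, F p = p ^ (β + ε p) := by
  have hlt : ∀ᶠ p : ℝ in 𝓝[>] 0, p < 1 := nhdsWithin_le_nhds (gt_mem_nhds one_pos)
  -- Solves `F p = p ^ (β + ε p)` for `ε`; as `log p < 0`, dividing by it reverses the two bounds.
  refine ⟨fun p => Real.log (F p) / Real.log p - β, ?_, ?_⟩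
  · rw [Metric.tendsto_nhds]
    intro e he
    filter_upwards [hlow (β + e / 2) (by linarith), hupp (β - e / 2) (by linarith),
      self_mem_nhdsWithin, hlt] with p h1 h2 (hp : 0 < p) hp1
    have hlog := Real.log_neg hp hp1
    have hF : 0 < F p := (Real.rpow_pos_of_pos hp _).trans_le h1
    have h1' := Real.log_le_log (Real.rpow_pos_of_pos hp _) h1
    have h2' := Real.log_le_log hF h2
    rw [Real.log_rpow hp] at h1' h2'
    have h3 : Real.log (F p) / Real.log p ≤ β + e / 2 := (div_le_iff_of_neg hlog).2 h1'
    have h4 : β - e / 2 ≤ Real.log (F p) / Real.log p := (le_div_iff_of_neg hlog).2 h2'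
    rw [Real.dist_eq, sub_zero, abs_lt]
    constructor <;> linarith
  · filter_upwards [hlow (β + 1) (by linarith), self_mem_nhdsWithin, hlt] with p h1 (hp : 0 < p) hp1
    have hF : 0 < F p := (Real.rpow_pos_of_pos hp _).trans_le h1
    rw [add_sub_cancel, Real.rpow_def_of_pos hp, mul_div_cancel₀ _ (Real.log_neg hp hp1).ne,
      Real.exp_log hF]

end DerridaRetaux

theorem theorem1p4
    -- the random variable `ν`, with values in `{1, 2, …}`, and `m = E(ν)`
    {Ω' : Type*} [MeasurableSpace Ω'] (Q : Measure Ω') [IsProbabilityMeasure Q]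
    (ν : Ω' → ℕ) (hν : Measurable ν) (hν_pos : ∀ᵐ ω ∂Q, 1 ≤ ν ω)
    (hν_exp : ∃ t : ℝ, 1 < t ∧ Integrable (fun ω => t ^ ν ω) Q)
    (m : ℝ) (hm : m = ∫ ω, (ν ω : ℝ) ∂Q) (hm_one : 1 < m)
    -- the random variable `Y₀`, with values in `(0, ∞)`
    {Ω : Type*} [MeasurableSpace Ω] (P : Measure Ω) [IsProbabilityMeasure P]
    (Y₀ : Ω → ℝ) (hY : Measurable Y₀) (hY_pos : ∀ᵐ ω ∂P, 0 < Y₀ ω)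
    (θ : ℝ) (hθ_pos : 0 < θ) (hθ_lt : θ < Real.log m)
    -- the exponential tail of `Y₀`
    (hY_tail : ∃ c₁ c₂ : ℝ, 0 < c₁ ∧ c₁ ≤ c₂ ∧ ∀ᶠ x : ℝ in atTop,
      c₁ * Real.exp (-θ * x) ≤ P.real {ω | x ≤ Y₀ ω} ∧
      P.real {ω | x ≤ Y₀ ω} ≤ c₂ * Real.exp (-θ * x)) :
    -- all the `X_n` have finite mean and the free energy is a genuine limit
    (∀ p : ℝ, 0 ≤ p → p ≤ 1 →
      (∀ n, Integrable (fun x : ℝ => x) (DerridaRetaux.law (Q.map ν) (P.map Y₀) p n)) ∧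
      Tendsto (DerridaRetaux.normalizedMean (Q.map ν) (P.map Y₀) p) atTop
        (𝓝 (DerridaRetaux.freeEnergy (Q.map ν) (P.map Y₀) p))) ∧
    -- `F_∞(p) = p ^ (β + o(1))` as `p ↓ 0`
    ∃ ε : ℝ → ℝ, Tendsto ε (𝓝[>] 0) (𝓝 0) ∧ ∀ᶠ p : ℝ in 𝓝[>] 0,
      DerridaRetaux.freeEnergy (Q.map ν) (P.map Y₀) p =
        p ^ (Real.log m / (Real.log m - θ) + ε p) := by
  have hρprob : IsProbabilityMeasure (Q.map ν) := Measure.isProbabilityMeasure_map hν.aemeasurable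
  have hηprob : IsProbabilityMeasure (P.map Y₀) := Measure.isProbabilityMeasure_map hY.aemeasurable
  have hmean : DerridaRetaux.offspringMean (Q.map ν) = m := by
    rw [DerridaRetaux.offspringMean, hm,
      integral_map hν.aemeasurable (measurable_of_countable _).aestronglyMeasurable]
  obtain ⟨t, ht, htν⟩ := hν_exp
  obtain ⟨d, rfl⟩ : ∃ d, t = 1 + d := ⟨t - 1, by ring⟩
  have hd : 0 < d := by linarith
  have hρ : Integrable (fun k : ℕ => (1 + d) ^ k) (Q.map ν) :=
    (integrable_map_measure (measurable_of_countable _).aestronglyMeasurable hν.aemeasurable).2 htν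
  have hη : ∀ᵐ x ∂(P.map Y₀), 0 ≤ x :=
    (ae_map_iff hY.aemeasurable measurableSet_Ici).2 (hY_pos.mono fun _ h => h.le)
  obtain ⟨c₁, c₂, hc₁, -, htail⟩ := hY_tail
  obtain ⟨x₀, hx₀⟩ := eventually_atTop.1 htail
  have hIci (x : ℝ) : (P.map Y₀).real (Set.Ici x) = P.real {ω | x ≤ Y₀ ω} :=
    map_measureReal_apply hY measurableSet_Ici
  have hlow (x : ℝ) (hx : x₀ ≤ x) : c₁ * Real.exp (-θ * x) ≤ (P.map Y₀).real (Set.Ici x) :=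
    (hIci x).symm ▸ (hx₀ x hx).1
  have hupp (x : ℝ) (hx : x₀ ≤ x) : (P.map Y₀).real (Set.Ici x) ≤ c₂ * Real.exp (-θ * x) :=
    (hIci x).symm ▸ (hx₀ x hx).2
  have hη' : DerridaRetaux.posMean (P.map Y₀) ≠ ⊤ := ne_top_of_le_ne_top
    (ENNReal.mul_ne_top ENNReal.ofReal_ne_top (DerridaRetaux.expMoment_ne_top_of_tail hθ_pos
      (half_pos hθ_pos).le (half_lt_self hθ_pos) hupp))
    (DerridaRetaux.posMean_le_expMoment (half_pos hθ_pos) _)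
  have hk := DerridaRetaux.integrable_natCast_of_pow hd hρ
  rw [← hmean] at hm_one hθ_lt
  refine ⟨fun p hp0 hp1 => ⟨DerridaRetaux.integrable_law hk hη hη' hp0 hp1,
    DerridaRetaux.tendsto_normalizedMean hk hm_one hη hη' hp0 hp1⟩, ?_⟩
  rw [← hmean]
  exact DerridaRetaux.exists_exponent_of_eventually_rpow_bounds
    (fun b hb => DerridaRetaux.eventually_rpow_le_freeEnergy hd hρ hm_one hη hη' hθ_pos hθ_lt hc₁
      hlow hb)
    (fun b hb => DerridaRetaux.eventually_freeEnergy_le_rpow hd hρ hm_one hη hθ_pos hθ_lt hupp hb)
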